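/- A labeled floor diagram of degree $d\ge 1$ and genus $0$ is a connected oriented multigraph on the vertex set $\{1,\dots,d\}$ with exactly $d-1$ edges, together with a positive integer weight $w(e)$ for each edge $e$, such that every edge is directed from a vertex $u$ to a vertex $v>u$, and such that for each vertex $v$ the total weight of the edges directed away from $v$ minus the total weight of the edges directed towards $v$ is at most $1$. For a given $a\in\{1,\dots,d-1\}$, the number of labeled floor diagrams of genus $0$ and degree $d$ containing an edge $a\to a+1$ with weight $1$ is equal to $2d^{d-3}$. In particular, this number does not depend on $a$. More generally, for $1\le a<a+b\le d$, the number of labeled floor diagrams of genus $0$ and degree $d$ which contain the edges $a\to a+1\to\cdots\to a+b$, all with weight $1$, is equal to $(b+1)d^{d-b-2}$. (Exponents may be negative; powers are taken in $\mathbb{Q}$.) -/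

import Mathlib

/-- An edge `source ⟶ target` of a weighted oriented graph on the vertex set `V`. -/
@[ext]
structure WeightedEdge (V : Type*) where
  source : V
  target : V
  weight : ℕ

/-- The divergence at `v` of a collection of weighted edges: the total weight of the edges directed
away from `v` minus the total weight of the edges directed towards `v`. -/
def edgeDivergence {V : Type*} [DecidableEq V] (E : Multiset (WeightedEdge V)) (v : V) : ℤ :=
  ((E.filter (fun e => e.source = v)).map (fun e => (e.weight : ℤ))).sum
    - ((E.filter (fun e => e.target = v)).map (fun e => (e.weight : ℤ))).sum

/-- The simple graph on `V` obtained by forgetting orientations, weights and multiplicities. -/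
def underlyingGraph {V : Type*} (E : Multiset (WeightedEdge V)) : SimpleGraph V :=
  SimpleGraph.fromRel (fun u v => ∃ e ∈ E, e.source = u ∧ e.target = v)

/-- A (connected) labeled floor diagram of genus `g` on the linearly ordered finite vertex set `V`;
its degree is the number of vertices. Multiple edges are allowed, so the weighted edges form a
multiset; two diagrams on `V` are equal exactly when these multisets are equal. -/
@[ext]
structure LabeledFloorDiagram (V : Type*) [LinearOrder V] [Fintype V] (g : ℕ) where
  edges : Multiset (WeightedEdge V)
  weight_pos : ∀ e ∈ edges, 0 < e.weight
  connected : (underlyingGraph edges).Connected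
  /-- The number of edges is `|V| + g - 1`. -/
  genus : edges.card + 1 = Fintype.card V + g
  source_lt_target : ∀ e ∈ edges, e.source < e.target
  divergence_le : ∀ v : V, edgeDivergence edges v ≤ 1

/-- The diagram, on the vertex set `{1, …, d}`, contains an edge `i ⟶ i + 1` of weight `1`. -/
def LabeledFloorDiagram.HasShortEdge {d g : ℕ} (D : LabeledFloorDiagram (Finset.Icc 1 d) g)
    (i : ℕ) : Prop :=
  ∃ e ∈ D.edges, (e.source : ℕ) = i ∧ (e.target : ℕ) = i + 1 ∧ e.weight = 1

/-!
A floor diagram of genus `0` on `{1, …, d}` is built by adding the vertices in increasing order.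
After `k` steps there is a forest on `{1, …, k}` whose components are again floor diagrams of genus
`0`. The new vertex `k + 1` receives at most one edge from each component `C` (two would close a
cycle), and such an edge is given by its source `v ∈ C` and a weight `w` with
`1 ≤ w ≤ 1 - div v`. The divergences in `C` add up to `0`, so there are exactly `|C|` such pairs
(`card_slots`): as many as there are ways to join a new vertex to a labeled tree on `C`. An edge
`k ⟶ k + 1` of weight `1` is always one of them, as no edge leaves `k` before step `k + 1`.

Hence the number of ways to complete a forest depends only on its component sizes and on the
component of `k`, and satisfies a recursion over the set of components joined to the new vertex.
With `r` vertices still to be added, `m` components, and `∏ |C|` and `∑ |C|` taken over the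
components, it is

* `∏ |C| * r ^ (m - 1) * d ^ (r - 1)` when no edge is prescribed any more;
* `d ^ (r - β - 1) * ∏ |C| * ((β + |C₀|) * r ^ m + β * (∑ |C|) * r ^ (m - 1))` when a chain of `β`
  edges starting at `k ∈ C₀` is prescribed, where `C₀` is left out of `∏`, `∑` and `m`;
* `(b + 1) * d ^ (r - b - 2) * ∏ |C| * (r ^ m + k * r ^ (m - 1))` before the chain of `b` edges has
  been reached.

Each formula follows from the recursion by the evaluation of three sums over subsets, combined in
`sum_powerset_prod_mul`. The empty forest, with `r = d`, gives `(b + 1) * d ^ (d - b - 2)`.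

That every floor diagram arises in this way (`IsFloorTree.mem_completions`) is a count of edges: the
vertex `k + 1` merges at most as many components as there are edges into it, and a connected diagram
with only `d - 1` edges forces equality at each step.
-/

namespace FloorDiagram

open Finset

/-! ### Sums over subsets -/

section SubsetSums

variable {ι R : Type*} [DecidableEq ι] [CommRing R]

lemma sum_powerset_pow_card_sdiff (P : Finset ι) (x : R) :
    ∑ S ∈ P.powerset, x ^ #(P \ S) = (1 + x) ^ #P := by
  rw [← Finset.sum_pow_mul_eq_add_pow]
  refine sum_congr rfl fun S hS => ?_
  rw [card_sdiff_of_subset (mem_powerset.1 hS)]; simp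

/-- The truncated exponents `#S - 1` and `#P - 1` are harmless: for an empty set the sum in front of
the power vanishes. -/
lemma sum_powerset_sum_mul_pow_card_sub_one (P : Finset ι) (c : ι → R) (x : R) :
    ∑ S ∈ P.powerset, (∑ i ∈ S, c i) * x ^ (#S - 1) = (∑ i ∈ P, c i) * (1 + x) ^ (#P - 1) := by
  induction P using Finset.induction_on with
  | empty => simp
  | insert j Q hj ih =>
    rw [sum_powerset_insert hj, ih]
    have key : ∀ S ∈ Q.powerset, (∑ i ∈ insert j S, c i) * x ^ (#(insert j S) - 1)
        = c j * x ^ #S + x * ((∑ i ∈ S, c i) * x ^ (#S - 1)) := by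
      intro S hS
      have hjS : j ∉ S := fun h => hj (mem_powerset.1 hS h)
      rw [sum_insert hjS, card_insert_of_notMem hjS, Nat.add_sub_cancel]
      rcases S.eq_empty_or_nonempty with rfl | hne
      · simp
      · rw [← Nat.sub_add_cancel hne.card_pos, pow_succ, Nat.add_sub_cancel]; ring
    have hpow : ∑ S ∈ Q.powerset, x ^ #S = (1 + x) ^ #Q := by
      rw [add_comm, ← Finset.sum_pow_mul_eq_add_pow]; simp
    rw [sum_congr rfl key, sum_add_distrib, ← mul_sum, ← mul_sum, ih, hpow, sum_insert hj,
      card_insert_of_notMem hj, Nat.add_sub_cancel]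
    rcases Q.eq_empty_or_nonempty with rfl | hne
    · simp
    · rw [← Nat.sub_add_cancel hne.card_pos, pow_succ, Nat.add_sub_cancel]; ring

lemma sum_powerset_sum_sdiff_mul_pow (P : Finset ι) (c : ι → R) (x : R) :
    ∑ S ∈ P.powerset, (∑ i ∈ P \ S, c i) * x ^ (#(P \ S) - 1)
      = (∑ i ∈ P, c i) * (1 + x) ^ (#P - 1) := by
  rw [← sum_powerset_sum_mul_pow_card_sub_one]
  refine sum_nbij' (fun S => P \ S) (fun S => P \ S) ?_ ?_ ?_ ?_ ?_ <;>
    simp +contextual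

lemma sum_powerset_sum_mul_pow_card_sdiff (P : Finset ι) (c : ι → R) (x : R) :
    ∑ S ∈ P.powerset, (∑ i ∈ S, c i) * x ^ #(P \ S) = (∑ i ∈ P, c i) * (1 + x) ^ (#P - 1) := by
  have h1 : ∀ S ∈ P.powerset, (∑ i ∈ S, c i) * x ^ #(P \ S)
      = (∑ i ∈ P, c i) * x ^ #(P \ S) - x * ((∑ i ∈ P \ S, c i) * x ^ (#(P \ S) - 1)) := by
    intro S hS
    rw [← sum_sdiff (mem_powerset.1 hS)]
    rcases (P \ S).eq_empty_or_nonempty with h | hne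
    · simp [h]
    · rw [← Nat.sub_add_cancel hne.card_pos, pow_succ, Nat.add_sub_cancel]; ring
  rw [sum_congr rfl h1, sum_sub_distrib, ← mul_sum, ← mul_sum, sum_powerset_pow_card_sdiff,
    sum_powerset_sum_sdiff_mul_pow]
  rcases P.eq_empty_or_nonempty with rfl | hne
  · simp
  · rw [← Nat.sub_add_cancel hne.card_pos, pow_succ, Nat.add_sub_cancel]; ring

end SubsetSums

/-! ### Partial transversals -/

section Transversals

variable {ι α : Type*} [DecidableEq α]

/-- The sets which consist of at most one element of each `A i`, `i ∈ P`. -/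
def partialTransversals (P : Finset ι) (A : ι → Finset α) : Finset (Finset α) :=
  {T ∈ (P.biUnion A).powerset | ∀ i ∈ P, #(T ∩ A i) ≤ 1}

/-- The indices of the members of the family `A` which `T` meets. -/
def hits (P : Finset ι) (A : ι → Finset α) (T : Finset α) : Finset ι :=
  {i ∈ P | (T ∩ A i).Nonempty}

lemma mem_partialTransversals {P : Finset ι} {A : ι → Finset α} {T : Finset α} :
    T ∈ partialTransversals P A ↔ T ⊆ P.biUnion A ∧ ∀ i ∈ P, #(T ∩ A i) ≤ 1 := by
  simp [partialTransversals]

lemma mem_hits {P : Finset ι} {A : ι → Finset α} {T : Finset α} {i : ι} :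
    i ∈ hits P A T ↔ i ∈ P ∧ ∃ x ∈ T, x ∈ A i := by
  simp [hits, Finset.Nonempty]

lemma hits_subset (P : Finset ι) (A : ι → Finset α) (T : Finset α) : hits P A T ⊆ P :=
  filter_subset _ _

lemma card_partialTransversals_hits_eq [DecidableEq ι] {P S : Finset ι} {A : ι → Finset α}
    (hA : (P : Set ι).PairwiseDisjoint A) (hS : S ⊆ P) :
    #{T ∈ partialTransversals P A | hits P A T = S} = ∏ i ∈ S, #(A i) := by
  have hdisj : ∀ {i j x}, i ∈ P → j ∈ P → x ∈ A i → x ∈ A j → i = j := fun hi hj hxi hxj =>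
    hA.elim_finset hi hj _ hxi hxj
  rw [← card_pi]
  symm
  refine card_bij (fun f _ => S.attach.image fun i => f i.1 i.2) ?_ ?_ ?_
  · intro f hf
    rw [mem_pi] at hf
    have hinter : ∀ i (hi : i ∈ S), (S.attach.image fun i => f i.1 i.2) ∩ A i = {f i hi} := by
      intro i hi
      ext x
      simp only [mem_inter, mem_image, mem_attach, true_and, Subtype.exists, mem_singleton]
      constructor
      · rintro ⟨⟨j, hj, rfl⟩, hx⟩
        obtain rfl := hdisj (hS hj) (hS hi) (hf j hj) hx
        rfl
      · rintro rfl
        exact ⟨⟨i, hi, rfl⟩, hf i hi⟩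
    have hempty : ∀ i ∈ P, i ∉ S → (S.attach.image fun i => f i.1 i.2) ∩ A i = ∅ := by
      intro i hi hiS
      ext x
      simp only [mem_inter, mem_image, mem_attach, true_and, Subtype.exists, notMem_empty,
        iff_false]
      rintro ⟨⟨j, hj, rfl⟩, hx⟩
      exact hiS (hdisj (hS hj) hi (hf j hj) hx ▸ hj)
    rw [mem_filter, mem_partialTransversals]
    refine ⟨⟨?_, ?_⟩, ?_⟩
    · intro x hx
      simp only [mem_image, mem_attach, true_and, Subtype.exists] at hx
      obtain ⟨i, hi, rfl⟩ := hx
      exact mem_biUnion.2 ⟨i, hS hi, hf i hi⟩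
    · intro i hi
      by_cases hiS : i ∈ S
      · simp [hinter i hiS]
      · simp [hempty i hi hiS]
    · ext i
      simp only [hits, mem_filter]
      constructor
      · rintro ⟨hi, hne⟩
        by_contra hiS
        simp [hempty i hi hiS] at hne
      · intro hiS
        exact ⟨hS hiS, by simp [hinter i hiS]⟩
  · intro f hf g hg hfg
    rw [mem_pi] at hf hg
    funext i hi
    have : f i hi ∈ S.attach.image fun i => g i.1 i.2 := by
      rw [← hfg]
      exact mem_image.2 ⟨⟨i, hi⟩, mem_attach _ _, rfl⟩
    simp only [mem_image, mem_attach, true_and, Subtype.exists] at this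
    obtain ⟨j, hj, hji⟩ := this
    obtain rfl := hdisj (hS hj) (hS hi) (hg j hj) (hji ▸ hf i hi)
    exact hji.symm
  · intro T hT
    rw [mem_filter, mem_partialTransversals] at hT
    obtain ⟨⟨hTs, hT1⟩, rfl⟩ := hT
    have hex : ∀ i (_ : i ∈ hits P A T), ∃ x, x ∈ T ∧ x ∈ A i := fun i hi => by
      simpa using (mem_hits.1 hi).2
    choose f hfT hfA using hex
    refine ⟨f, by simpa [mem_pi] using hfA, ?_⟩
    ext x
    simp only [mem_image, mem_attach, true_and, Subtype.exists]
    constructor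
    · rintro ⟨i, hi, rfl⟩
      exact hfT i hi
    · intro hx
      obtain ⟨i, hi, hxi⟩ := mem_biUnion.1 (hTs hx)
      have hih : i ∈ hits P A T := mem_hits.2 ⟨hi, x, hx, hxi⟩
      exact ⟨i, hih, card_le_one.1 (hT1 i hi) _ (mem_inter.2 ⟨hfT i hih, hfA i hih⟩) _
        (mem_inter.2 ⟨hx, hxi⟩)⟩

lemma sum_partialTransversals [DecidableEq ι] {R : Type*} [CommSemiring R] {P : Finset ι}
    {A : ι → Finset α}
    (hA : (P : Set ι).PairwiseDisjoint A) (g : Finset ι → R) :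
    ∑ T ∈ partialTransversals P A, g (hits P A T)
      = ∑ S ∈ P.powerset, (∏ i ∈ S, (#(A i) : R)) * g S := by
  rw [← sum_fiberwise_of_maps_to (g := hits P A) (t := P.powerset)
    fun T _ => mem_powerset.2 (hits_subset P A T)]
  refine sum_congr rfl fun S hS => ?_
  rw [sum_congr rfl (g := fun _ => g S) fun T hT => by rw [(mem_filter.1 hT).2], sum_const,
    card_partialTransversals_hits_eq hA (mem_powerset.1 hS), nsmul_eq_mul, Nat.cast_prod]

/-- Partial transversals through a given element `x` of `A i₀` arise by adding `x` to a partial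
transversal of the remaining sets. -/
lemma sum_partialTransversals_mem [DecidableEq ι] {R : Type*} [CommSemiring R] {P : Finset ι}
    {A : ι → Finset α} (hA : (P : Set ι).PairwiseDisjoint A) {i₀ : ι} (hi₀ : i₀ ∈ P) {x : α}
    (hx : x ∈ A i₀) (g : Finset ι → R) :
    ∑ T ∈ partialTransversals P A with x ∈ T, g (hits P A T)
      = ∑ S ∈ (P.erase i₀).powerset, (∏ i ∈ S, (#(A i) : R)) * g (insert i₀ S) := by
  have hdisj : ∀ {i j x}, i ∈ P → j ∈ P → x ∈ A i → x ∈ A j → i = j := fun hi hj hxi hxj =>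
    hA.elim_finset hi hj _ hxi hxj
  rw [← sum_partialTransversals (hA.subset (by simp)) fun S => g (insert i₀ S)]
  have hxT : ∀ T ∈ partialTransversals (P.erase i₀) A, x ∉ T := fun T hT hxT => by
    obtain ⟨i, hi, hxi⟩ := mem_biUnion.1 ((mem_partialTransversals.1 hT).1 hxT)
    exact (mem_erase.1 hi).1 (hdisj (mem_erase.1 hi).2 hi₀ hxi hx)
  refine sum_bij' (fun T _ => T.erase x) (fun T _ => insert x T) ?_ ?_ ?_ ?_ ?_
  · intro T hT
    simp only [mem_filter, mem_partialTransversals] at hT ⊢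
    obtain ⟨⟨h1, h2⟩, h3⟩ := hT
    refine ⟨fun y hy => ?_, fun i hi => ?_⟩
    · obtain ⟨hyx, hyT⟩ := mem_erase.1 hy
      obtain ⟨i, hi, hyi⟩ := mem_biUnion.1 (h1 hyT)
      refine mem_biUnion.2 ⟨i, mem_erase.2 ⟨?_, hi⟩, hyi⟩
      rintro rfl
      exact hyx (card_le_one.1 (h2 i hi) _ (mem_inter.2 ⟨hyT, hyi⟩) _ (mem_inter.2 ⟨h3, hx⟩))
    · exact (card_le_card (inter_subset_inter_right (erase_subset _ _))).trans
        (h2 i (mem_erase.1 hi).2)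
  · intro T hT
    have hxT' := hxT T hT
    simp only [mem_filter, mem_partialTransversals] at hT ⊢
    obtain ⟨h1, h2⟩ := hT
    refine ⟨⟨fun y hy => ?_, fun i hi => ?_⟩, mem_insert_self _ _⟩
    · rcases mem_insert.1 hy with rfl | hy
      · exact mem_biUnion.2 ⟨i₀, hi₀, hx⟩
      · exact biUnion_subset_biUnion_of_subset_left _ (erase_subset _ _) (h1 hy)
    · rw [card_le_one]
      intro y hy z hz
      rw [mem_inter, mem_insert] at hy hz
      by_cases hii : i = i₀
      · subst hii
        have : ∀ y, (y = x ∨ y ∈ T) ∧ y ∈ A i → y = x := by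
          rintro y ⟨rfl | hyT, hyi⟩
          · rfl
          · obtain ⟨j, hj, hyj⟩ := mem_biUnion.1 (h1 hyT)
            exact absurd (hdisj (mem_erase.1 hj).2 hi hyj hyi) (mem_erase.1 hj).1
        rw [this y hy, this z hz]
      · have : ∀ y, (y = x ∨ y ∈ T) ∧ y ∈ A i → y ∈ T ∩ A i := by
          rintro y ⟨rfl | hyT, hyi⟩
          · exact absurd (hdisj hi hi₀ hyi hx) hii
          · exact mem_inter.2 ⟨hyT, hyi⟩
        exact card_le_one.1 (h2 i (mem_erase.2 ⟨hii, hi⟩)) _ (this y hy) _ (this z hz)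
  · intro T hT
    exact insert_erase (mem_filter.1 hT).2
  · intro T hT
    exact erase_insert (hxT T hT)
  · intro T hT
    have h3 := (mem_filter.1 hT).2
    congr 1
    ext i
    simp only [mem_hits, mem_insert, mem_erase]
    constructor
    · rintro ⟨hi, y, hyT, hyi⟩
      by_cases hii : i = i₀
      · exact Or.inl hii
      · refine Or.inr ⟨⟨hii, hi⟩, y, ⟨?_, hyT⟩, hyi⟩
        rintro rfl
        exact hii (hdisj hi hi₀ hyi hx)
    · rintro (rfl | ⟨⟨_, hi⟩, y, ⟨_, hyT⟩, hyi⟩)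
      · exact ⟨hi₀, x, h3, hx⟩
      · exact ⟨hi, y, hyT, hyi⟩

lemma card_hits_eq_sum (P : Finset ι) (A : ι → Finset α) (T : Finset α) :
    #(hits P A T) = ∑ i ∈ P, min #(T ∩ A i) 1 := by
  rw [hits, card_filter]
  refine sum_congr rfl fun i _ => ?_
  split_ifs with h
  · have := h.card_pos
    omega
  · simp [not_nonempty_iff_eq_empty.1 h]

lemma card_eq_sum_card_inter {P : Finset ι} {A : ι → Finset α} {T : Finset α}
    (hA : (P : Set ι).PairwiseDisjoint A) (hT : T ⊆ P.biUnion A) :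
    #T = ∑ i ∈ P, #(T ∩ A i) := by
  rw [← card_biUnion fun i hi j hj hij =>
    (hA hi hj hij).mono inter_subset_right inter_subset_right, ← inter_biUnion,
    inter_eq_left.2 hT]

lemma card_hits_le {P : Finset ι} {A : ι → Finset α} {T : Finset α}
    (hA : (P : Set ι).PairwiseDisjoint A) (hT : T ⊆ P.biUnion A) : #(hits P A T) ≤ #T := by
  rw [card_hits_eq_sum, card_eq_sum_card_inter hA hT]
  exact sum_le_sum fun i _ => min_le_left _ _

lemma card_hits_eq_iff {P : Finset ι} {A : ι → Finset α} {T : Finset α}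
    (hA : (P : Set ι).PairwiseDisjoint A) (hT : T ⊆ P.biUnion A) :
    #(hits P A T) = #T ↔ T ∈ partialTransversals P A := by
  rw [card_hits_eq_sum, card_eq_sum_card_inter hA hT, mem_partialTransversals,
    sum_eq_sum_iff_of_le fun i _ => min_le_left _ _]
  simp [hT]

end Transversals

/-! ### Divergence -/

section Divergence

variable {V : Type*} [DecidableEq V]

lemma edgeDivergence_add (E F : Multiset (WeightedEdge V)) (v : V) :
    edgeDivergence (E + F) v = edgeDivergence E v + edgeDivergence F v := by
  simp only [edgeDivergence, Multiset.filter_add, Multiset.map_add, Multiset.sum_add]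
  ring

@[simp]
lemma edgeDivergence_zero (v : V) : edgeDivergence (0 : Multiset (WeightedEdge V)) v = 0 := by
  simp [edgeDivergence]

lemma edgeDivergence_cons (e : WeightedEdge V) (E : Multiset (WeightedEdge V)) (v : V) :
    edgeDivergence (e ::ₘ E) v = edgeDivergence E v
      + ((if e.source = v then (e.weight : ℤ) else 0)
        - if e.target = v then (e.weight : ℤ) else 0) := by
  by_cases h1 : e.source = v <;> by_cases h2 : e.target = v <;>
    simp [edgeDivergence, h1, h2] <;> ring

lemma sum_edgeDivergence_eq_zero {E : Multiset (WeightedEdge V)} {C : Finset V}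
    (hC : ∀ e ∈ E, (e.source ∈ C ↔ e.target ∈ C)) : ∑ v ∈ C, edgeDivergence E v = 0 := by
  induction E using Multiset.induction_on with
  | empty => simp
  | cons e E ih =>
    have h := hC e (Multiset.mem_cons_self e E)
    simp only [edgeDivergence_cons, sum_add_distrib, sum_sub_distrib, sum_ite_eq]
    rw [ih fun e' he' => hC e' (Multiset.mem_cons_of_mem he')]
    simp [h]

lemma edgeDivergence_nonneg {E : Multiset (WeightedEdge V)} {v : V}
    (h : ∀ e ∈ E, e.target ≠ v) : 0 ≤ edgeDivergence E v := by
  rw [edgeDivergence, Multiset.filter_eq_nil.2 h]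
  simp only [Multiset.map_zero, Multiset.sum_zero, sub_zero]
  refine Multiset.sum_nonneg fun x hx => ?_
  obtain ⟨e, _, rfl⟩ := Multiset.mem_map.1 hx
  positivity

lemma edgeDivergence_nonpos {E : Multiset (WeightedEdge V)} {v : V}
    (h : ∀ e ∈ E, e.source ≠ v) : edgeDivergence E v ≤ 0 := by
  rw [edgeDivergence, Multiset.filter_eq_nil.2 h]
  simp only [Multiset.map_zero, Multiset.sum_zero, zero_sub, Left.neg_nonpos_iff]
  refine Multiset.sum_nonneg fun x hx => ?_
  obtain ⟨e, _, rfl⟩ := Multiset.mem_map.1 hx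
  positivity

end Divergence

/-! ### Adding vertices one at a time -/

/-- The pairs `(v, w)` such that a new edge of weight `w` leaving the vertex `v` of `C` keeps the
divergence at `v` at most `1`. -/
def slots (E : Multiset (WeightedEdge ℕ)) (C : Finset ℕ) : Finset (Σ _ : ℕ, ℕ) :=
  C.sigma fun v => Icc 1 (1 - edgeDivergence E v).toNat

/-- The edges into the vertex `k + 1` with sources and weights listed by `T`. -/
def incoming (k : ℕ) (T : Finset (Σ _ : ℕ, ℕ)) : Multiset (WeightedEdge ℕ) :=
  T.val.map fun p => ⟨p.1, k + 1, p.2⟩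

/-- The partition that arises from `P` when the new vertex `k + 1` is joined to the blocks in
`S`. -/
def mergeBlocks (k : ℕ) (P S : Finset (Finset ℕ)) : Finset (Finset ℕ) :=
  insert (insert (k + 1) (S.biUnion id)) (P \ S)

/-- `P` is a partition of `{1, …, k}` into nonempty blocks. -/
structure IsPartition (k : ℕ) (P : Finset (Finset ℕ)) : Prop where
  disjoint : (P : Set (Finset ℕ)).PairwiseDisjoint id
  nonempty : ∀ C ∈ P, C.Nonempty
  biUnion_eq : P.biUnion id = Icc 1 k

/-- `E` is the edge multiset of a forest on `{1, …, k}` whose components, listed by `P`, are floor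
diagrams of genus `0`. A component is required to be connected in the form: a property of vertices
which is invariant along edges is constant on it. -/
structure IsFloorForest (k : ℕ) (E : Multiset (WeightedEdge ℕ)) (P : Finset (Finset ℕ)) :
    Prop extends IsPartition k P where
  weight_pos : ∀ e ∈ E, 0 < e.weight
  source_lt_target : ∀ e ∈ E, e.source < e.target
  target_le : ∀ e ∈ E, e.target ≤ k
  mem_block_iff : ∀ e ∈ E, ∀ C ∈ P, (e.source ∈ C ↔ e.target ∈ C)
  divergence_le : ∀ v, edgeDivergence E v ≤ 1
  card_add_card : E.card + #P = k
  connected : ∀ C ∈ P, ∀ Q : ℕ → Prop, (∀ e ∈ E, (Q e.source ↔ Q e.target)) →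
    ∀ u ∈ C, ∀ v ∈ C, Q u → Q v

section Slots

variable {k : ℕ} {E : Multiset (WeightedEdge ℕ)} {C : Finset ℕ} {P S : Finset (Finset ℕ)}
  {T : Finset (Σ _ : ℕ, ℕ)}

lemma mem_slots {v w : ℕ} :
    (⟨v, w⟩ : Σ _ : ℕ, ℕ) ∈ slots E C ↔ v ∈ C ∧ 1 ≤ w ∧ edgeDivergence E v + w ≤ 1 := by
  simp only [slots, mem_sigma, mem_Icc]
  have : 1 ≤ w → (w ≤ (1 - edgeDivergence E v).toNat ↔ edgeDivergence E v + w ≤ 1) := by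
    intro h
    omega
  tauto

/-- The number of slots of a component is its number of vertices, since the divergences in a
component add up to `0`. -/
lemma card_slots (hdiv : ∀ v, edgeDivergence E v ≤ 1)
    (hC : ∀ e ∈ E, (e.source ∈ C ↔ e.target ∈ C)) : #(slots E C) = #C := by
  zify
  rw [slots, card_sigma, Nat.cast_sum]
  have : ∀ v ∈ C, ((#(Icc 1 (1 - edgeDivergence E v).toNat) : ℕ) : ℤ)
      = 1 - edgeDivergence E v := fun v _ => by
    have := hdiv v
    rw [Nat.card_Icc]
    omega
  rw [sum_congr rfl this, sum_sub_distrib, sum_edgeDivergence_eq_zero hC]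
  simp

namespace IsPartition

lemma eq_of_mem (h : IsPartition k P) {C D : Finset ℕ} (hC : C ∈ P) (hD : D ∈ P) {v : ℕ}
    (hvC : v ∈ C) (hvD : v ∈ D) : C = D :=
  h.disjoint.elim_finset hC hD v hvC hvD

lemma mem_Icc (h : IsPartition k P) (hC : C ∈ P) {v : ℕ} (hv : v ∈ C) : 1 ≤ v ∧ v ≤ k := by
  rw [← Finset.mem_Icc, ← h.biUnion_eq]
  exact mem_biUnion.2 ⟨C, hC, hv⟩

lemma exists_mem (h : IsPartition k P) {v : ℕ} (h1 : 1 ≤ v) (h2 : v ≤ k) : ∃ C ∈ P, v ∈ C := by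
  have : v ∈ P.biUnion id := by
    rw [h.biUnion_eq]
    exact Finset.mem_Icc.2 ⟨h1, h2⟩
  simpa using this

lemma sum_card (h : IsPartition k P) : ∑ C ∈ P, #C = k := by
  have := card_biUnion fun C hC D hD hCD => h.disjoint (mem_coe.2 hC) (mem_coe.2 hD) hCD
  rw [h.biUnion_eq, Nat.card_Icc] at this
  simpa using this.symm

lemma empty : IsPartition 0 ∅ := ⟨by simp, by simp, by simp⟩

lemma slots_disjoint (h : IsPartition k P) (E : Multiset (WeightedEdge ℕ)) :
    (P : Set (Finset ℕ)).PairwiseDisjoint (slots E) := by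
  intro C hC D hD hCD
  rw [Function.onFun, Finset.disjoint_left]
  rintro ⟨v, w⟩ hx hy
  exact hCD (h.eq_of_mem hC hD (mem_slots.1 hx).1 (mem_slots.1 hy).1)

lemma new_notMem (h : IsPartition k P) (S : Finset (Finset ℕ)) (X : Finset ℕ) :
    insert (k + 1) X ∉ P \ S := fun hm => by
  have := (h.mem_Icc (mem_sdiff.1 hm).1 (mem_insert_self _ _)).2
  omega

lemma card_mergeBlocks (h : IsPartition k P) (hS : S ⊆ P) :
    #(mergeBlocks k P S) + #S = #P + 1 := by
  rw [mergeBlocks, card_insert_of_notMem (h.new_notMem _ _), card_sdiff_of_subset hS]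
  have := card_le_card hS
  omega

lemma card_new (h : IsPartition k P) (hS : S ⊆ P) :
    #(insert (k + 1) (S.biUnion id)) = 1 + ∑ C ∈ S, #C := by
  rw [card_insert_of_notMem, card_biUnion, add_comm]
  · rfl
  · exact fun C hC D hD hCD => h.disjoint (mem_coe.2 (hS hC)) (mem_coe.2 (hS hD)) hCD
  · intro hm
    obtain ⟨C, hC, hk⟩ := mem_biUnion.1 hm
    have := (h.mem_Icc (hS hC) hk).2
    omega

lemma merge (h : IsPartition k P) (hS : S ⊆ P) : IsPartition (k + 1) (mergeBlocks k P S) := by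
  have hnew : ∀ D ∈ P \ S, ∀ v ∈ insert (k + 1) (S.biUnion id), v ∉ D := by
    intro D hD v hv hvD
    obtain ⟨hDP, hDS⟩ := mem_sdiff.1 hD
    rcases mem_insert.1 hv with rfl | hv
    · have := (h.mem_Icc hDP hvD).2
      omega
    · obtain ⟨C, hC, hvC⟩ := mem_biUnion.1 hv
      exact hDS (h.eq_of_mem (hS hC) hDP hvC hvD ▸ hC)
  refine ⟨?_, ?_, ?_⟩
  · rw [mergeBlocks, coe_insert]
    refine Set.PairwiseDisjoint.insert (h.disjoint.subset (coe_subset.2 sdiff_subset)) ?_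
    intro D hD _
    exact Finset.disjoint_left.2 fun v hv => hnew D (mem_coe.1 hD) v hv
  · intro C hC
    rcases mem_insert.1 hC with rfl | hC
    · exact insert_nonempty _ _
    · exact h.nonempty C (mem_sdiff.1 hC).1
  · rw [mergeBlocks, biUnion_insert, id, insert_union, ← union_biUnion,
      union_sdiff_of_subset hS, h.biUnion_eq]
    ext v
    simp only [mem_insert, Finset.mem_Icc]
    omega

end IsPartition

end Slots

section Step

variable {k : ℕ} {E : Multiset (WeightedEdge ℕ)} {P : Finset (Finset ℕ)}
  {T : Finset (Σ _ : ℕ, ℕ)}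

lemma mem_incoming {e : WeightedEdge ℕ} :
    e ∈ incoming k T ↔ e.target = k + 1 ∧ (⟨e.source, e.weight⟩ : Σ _ : ℕ, ℕ) ∈ T := by
  simp only [incoming, Multiset.mem_map, mem_val]
  constructor
  · rintro ⟨p, hp, rfl⟩
    exact ⟨rfl, hp⟩
  · rintro ⟨h, hT⟩
    exact ⟨_, hT, by ext <;> simp [h]⟩

lemma incoming_injective (k : ℕ) : Function.Injective (incoming k) := by
  intro T T' h
  rw [← val_inj]
  refine Multiset.map_injective (fun p q hpq => ?_) h
  simp only [WeightedEdge.mk.injEq, true_and] at hpq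
  exact Sigma.ext hpq.1 (heq_of_eq hpq.2)

/-- The edges of `E` and the new edges listed by `T` stay within the merged blocks. -/
lemma mem_block_iff_mergeBlocks (hP : IsPartition k P) {E' : Multiset (WeightedEdge ℕ)}
    (hlt : ∀ e ∈ E, e.source < e.target) (hle : ∀ e ∈ E, e.target ≤ k)
    (hE : ∀ e ∈ E, ∀ C ∈ P, (e.source ∈ C ↔ e.target ∈ C)) (hT : T ⊆ P.biUnion (slots E))
    (hE' : ∀ e ∈ E', e ∈ E ∨ e.target = k + 1 ∧ (⟨e.source, e.weight⟩ : Σ _ : ℕ, ℕ) ∈ T) :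
    ∀ e ∈ E', ∀ C ∈ mergeBlocks k P (hits P (slots E) T), (e.source ∈ C ↔ e.target ∈ C) := by
  intro e he D hD
  rcases hE' e he with heE | ⟨hek, heT⟩
  · have h1 := hlt e heE
    have h2 := hle e heE
    rcases mem_insert.1 hD with rfl | hD
    · simp only [mem_insert, mem_biUnion, id]
      rw [or_iff_right (by omega), or_iff_right (by omega)]
      exact exists_congr fun C => and_congr_right fun hC => hE e heE C (hits_subset _ _ _ hC)
    · exact hE e heE D (mem_sdiff.1 hD).1
  · obtain ⟨C, hC, hs⟩ := mem_biUnion.1 (hT heT)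
    have hCh : C ∈ hits P (slots E) T := mem_hits.2 ⟨hC, _, heT, hs⟩
    have hsC := (mem_slots.1 hs).1
    rcases mem_insert.1 hD with rfl | hD
    · refine iff_of_true (mem_insert_of_mem (mem_biUnion.2 ⟨C, hCh, hsC⟩)) ?_
      rw [hek]
      exact mem_insert_self _ _
    · obtain ⟨hDP, hDS⟩ := mem_sdiff.1 hD
      refine iff_of_false (fun h => hDS (hP.eq_of_mem hC hDP hsC h ▸ hCh)) fun h => ?_
      have := (hP.mem_Icc hDP h).2
      omega

lemma IsFloorForest.empty : IsFloorForest 0 0 ∅ where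
  __ := IsPartition.empty
  weight_pos := by simp
  source_lt_target := by simp
  target_le := by simp
  mem_block_iff := by simp
  divergence_le := by simp
  card_add_card := by simp
  connected := by simp

lemma IsFloorForest.divergence_add_le (h : IsFloorForest k E P)
    (hT : T ∈ partialTransversals P (slots E)) (v : ℕ) :
    edgeDivergence (E + incoming k T) v ≤ 1 := by
  obtain ⟨hTs, hT1⟩ := mem_partialTransversals.1 hT
  rw [edgeDivergence_add]
  by_cases hv : ∃ w, (⟨v, w⟩ : Σ _ : ℕ, ℕ) ∈ T
  · obtain ⟨w, hw⟩ := hv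
    obtain ⟨C, hC, hs⟩ := mem_biUnion.1 (hTs hw)
    obtain ⟨hvC, -, hdiv⟩ := mem_slots.1 hs
    -- `(v, w)` is the only element of `T` at `v`, as `v` lies in a single block
    have huniq : ∀ p ∈ T, p ≠ ⟨v, w⟩ → p.1 ≠ v := by
      rintro ⟨v', w'⟩ hp hne rfl
      obtain ⟨C', hC', hs'⟩ := mem_biUnion.1 (hTs hp)
      obtain rfl := h.eq_of_mem hC hC' hvC (mem_slots.1 hs').1
      exact hne (card_le_one.1 (hT1 C hC) _ (mem_inter.2 ⟨hp, hs'⟩) _ (mem_inter.2 ⟨hw, hs⟩))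
    have hcons : incoming k T = ⟨v, k + 1, w⟩ ::ₘ incoming k (T.erase ⟨v, w⟩) := by
      have hval : T.val = ⟨v, w⟩ ::ₘ (T.erase ⟨v, w⟩).val := by
        rw [← insert_val_of_notMem (notMem_erase _ _), insert_erase hw]
      rw [incoming, hval, Multiset.map_cons]
      rfl
    have hrest : edgeDivergence (incoming k (T.erase ⟨v, w⟩)) v ≤ 0 :=
      edgeDivergence_nonpos fun e he hev => by
        obtain ⟨hne, hmem⟩ := mem_erase.1 (mem_incoming.1 he).2
        exact huniq _ hmem hne hev
    rw [hcons, edgeDivergence_cons]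
    have := (h.mem_Icc hC hvC).2
    rw [if_pos rfl, if_neg (by simp only; omega)]
    simp only
    omega
  · have := h.divergence_le v
    have : edgeDivergence (incoming k T) v ≤ 0 := edgeDivergence_nonpos fun e he hev => by
      have := (mem_incoming.1 he).2
      rw [hev] at this
      exact hv ⟨_, this⟩
    omega

/-- Joining the new vertex to a partial transversal of the slots yields a floor forest again. -/
lemma IsFloorForest.add_vertex (h : IsFloorForest k E P)
    (hT : T ∈ partialTransversals P (slots E)) :
    IsFloorForest (k + 1) (E + incoming k T) (mergeBlocks k P (hits P (slots E) T)) := by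
  have hTs := (mem_partialTransversals.1 hT).1
  have hslot : ∀ e ∈ incoming k T, e.target = k + 1 ∧
      ∃ C ∈ hits P (slots E) T, C ∈ P ∧ e.source ∈ C ∧ 1 ≤ e.weight := by
    intro e he
    obtain ⟨h1, h2⟩ := mem_incoming.1 he
    obtain ⟨C, hC, hs⟩ := mem_biUnion.1 (hTs h2)
    exact ⟨h1, C, mem_hits.2 ⟨hC, _, h2, hs⟩, hC, (mem_slots.1 hs).1, (mem_slots.1 hs).2.1⟩
  refine ⟨h.toIsPartition.merge (hits_subset _ _ _), ?_, ?_, ?_, ?_, ?_, ?_, ?_⟩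
  · intro e he
    rcases Multiset.mem_add.1 he with he | he
    · exact h.weight_pos e he
    · obtain ⟨-, C, -, -, -, hw⟩ := hslot e he
      exact hw
  · intro e he
    rcases Multiset.mem_add.1 he with he | he
    · exact h.source_lt_target e he
    · obtain ⟨h1, C, -, hC, hv, -⟩ := hslot e he
      have := (h.mem_Icc hC hv).2
      omega
  · intro e he
    rcases Multiset.mem_add.1 he with he | he
    · exact (h.target_le e he).trans (Nat.le_succ k)
    · exact (hslot e he).1.le
  · refine mem_block_iff_mergeBlocks h.toIsPartition h.source_lt_target h.target_le
      h.mem_block_iff hTs fun e he => ?_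
    rw [← mem_incoming]
    exact Multiset.mem_add.1 he
  · exact h.divergence_add_le hT
  · have h1 := h.toIsPartition.card_mergeBlocks (hits_subset P (slots E) T)
    have h2 := h.card_add_card
    rw [(card_hits_eq_iff (h.slots_disjoint E) hTs).2 hT] at h1
    rw [Multiset.card_add, incoming, Multiset.card_map, card_val]
    omega
  · intro D hD Q hQ
    have hQE : ∀ e ∈ E, (Q e.source ↔ Q e.target) := fun e he =>
      hQ e (Multiset.mem_add.2 (Or.inl he))
    rcases mem_insert.1 hD with rfl | hD
    · have hnew : ∀ u ∈ insert (k + 1) ((hits P (slots E) T).biUnion id), (Q u ↔ Q (k + 1)) := by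
        intro u hu
        rcases mem_insert.1 hu with rfl | hu
        · rfl
        obtain ⟨C, hC, huC⟩ := mem_biUnion.1 hu
        obtain ⟨hCP, ⟨v, w⟩, hxT, hxC⟩ := mem_hits.1 hC
        have hvC := (mem_slots.1 hxC).1
        have hv : Q v ↔ Q (k + 1) := hQ ⟨v, k + 1, w⟩
          (Multiset.mem_add.2 (Or.inr (mem_incoming.2 ⟨rfl, hxT⟩)))
        rw [← hv]
        exact ⟨h.connected C hCP Q hQE u huC v hvC, h.connected C hCP Q hQE v hvC u huC⟩
      intro u hu v hv
      rw [hnew u hu, hnew v hv]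
      exact id
    · exact h.connected D (mem_sdiff.1 hD).1 Q hQE

end Step

/-! ### Counting completions -/

section Completions

noncomputable instance : DecidableEq (WeightedEdge ℕ) := Classical.decEq _

/-- The edge multisets of the floor diagrams of genus `0` which arise from the forest `E` on
`{1, …, k}` with components `P` by adding `r` vertices one at a time, where for each `i ∈ I` with
`k ≤ i < k + r` an edge `i ⟶ i + 1` of weight `1` is prescribed. -/
noncomputable def completions (I : Finset ℕ) :
    ℕ → ℕ → Multiset (WeightedEdge ℕ) → Finset (Finset ℕ) → Finset (Multiset (WeightedEdge ℕ))
  | 0, _, E, P => if #P = 1 then {E} else ∅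
  | r + 1, k, E, P =>
    {T ∈ partialTransversals P (slots E) | k ∈ I → (⟨k, 1⟩ : Σ _ : ℕ, ℕ) ∈ T}.biUnion fun T =>
      completions I r (k + 1) (E + incoming k T) (mergeBlocks k P (hits P (slots E) T))

variable {I : Finset ℕ} {r k : ℕ} {E F : Multiset (WeightedEdge ℕ)} {P : Finset (Finset ℕ)}

lemma mem_completions_succ :
    F ∈ completions I (r + 1) k E P ↔ ∃ T ∈ partialTransversals P (slots E),
      (k ∈ I → (⟨k, 1⟩ : Σ _ : ℕ, ℕ) ∈ T) ∧ F ∈ completions I r (k + 1) (E + incoming k T)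
        (mergeBlocks k P (hits P (slots E) T)) := by
  simp only [completions, mem_biUnion, mem_filter, and_assoc]

lemma filter_add_incoming (hE : ∀ e ∈ E, e.target ≤ k) (T : Finset (Σ _ : ℕ, ℕ)) :
    (E + incoming k T).filter (fun e => e.target ≤ k) = E := by
  rw [Multiset.filter_add, Multiset.filter_eq_self.2 hE, Multiset.filter_eq_nil.2, add_zero]
  intro e he
  rw [(mem_incoming.1 he).1]
  omega

lemma target_le_add_incoming (hE : ∀ e ∈ E, e.target ≤ k) (T : Finset (Σ _ : ℕ, ℕ)) :
    ∀ e ∈ E + incoming k T, e.target ≤ k + 1 := by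
  intro e he
  rcases Multiset.mem_add.1 he with he | he
  · exact (hE e he).trans (Nat.le_succ k)
  · exact (mem_incoming.1 he).1.le

/-- A completion determines the forest it completes, so completions of different forests differ. -/
lemma filter_of_mem_completions (hE : ∀ e ∈ E, e.target ≤ k) (hF : F ∈ completions I r k E P) :
    F.filter (fun e => e.target ≤ k) = E := by
  induction r generalizing k E P with
  | zero =>
    rw [completions] at hF
    split_ifs at hF
    · rw [mem_singleton.1 hF]
      exact Multiset.filter_eq_self.2 hE
    · simp at hF
  | succ r ih =>
    obtain ⟨T, -, -, hFT⟩ := mem_completions_succ.1 hF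
    have := congrArg (Multiset.filter fun e : WeightedEdge ℕ => e.target ≤ k)
      (ih (target_le_add_incoming hE T) hFT)
    rw [filter_add_incoming hE, Multiset.filter_filter] at this
    rw [← this]
    refine Multiset.filter_congr fun e _ => ?_
    omega

lemma card_completions_succ (hE : ∀ e ∈ E, e.target ≤ k) :
    #(completions I (r + 1) k E P)
      = ∑ T ∈ partialTransversals P (slots E) with (k ∈ I → (⟨k, 1⟩ : Σ _ : ℕ, ℕ) ∈ T),
        #(completions I r (k + 1) (E + incoming k T)
          (mergeBlocks k P (hits P (slots E) T))) := by
  rw [completions, card_biUnion]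
  intro T _ T' _ hne
  rw [Function.onFun, Finset.disjoint_left]
  intro F hF hF'
  have h1 := filter_of_mem_completions (target_le_add_incoming hE T) hF
  have h2 := filter_of_mem_completions (target_le_add_incoming hE T') hF'
  exact hne (incoming_injective k (add_left_cancel (h1.symm.trans h2)))

variable {R : Type*} [CommSemiring R]

/-- The recursion for the number of completions when no edge `k ⟶ k + 1` is prescribed, provided
that the numbers `g S` of completions after the next step depend only on the set `S` of merged
blocks. -/
lemma card_completions_of_notMem (h : IsFloorForest k E P) (hk : k ∉ I)
    {g : Finset (Finset ℕ) → R}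
    (hg : ∀ S ⊆ P, ∀ E', IsFloorForest (k + 1) E' (mergeBlocks k P S) →
      (#(completions I r (k + 1) E' (mergeBlocks k P S)) : R) = g S) :
    (#(completions I (r + 1) k E P) : R)
      = ∑ S ∈ P.powerset, (∏ C ∈ S, (#C : R)) * g S := by
  rw [card_completions_succ h.target_le, Nat.cast_sum, filter_true_of_mem (by simp [hk]),
    sum_congr rfl fun T hT => hg _ (hits_subset P (slots E) T) _ (h.add_vertex hT),
    sum_partialTransversals (h.slots_disjoint E)]
  refine sum_congr rfl fun S hS => ?_
  congr 1
  refine prod_congr rfl fun C hC => ?_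
  rw [card_slots h.divergence_le fun e he => h.mem_block_iff e he C (mem_powerset.1 hS hC)]

/-- The recursion for the number of completions when the edge `k ⟶ k + 1` of weight `1` is
prescribed, so that the block `C₀` of `k` is always merged, in one way. -/
lemma card_completions_of_mem (h : IsFloorForest k E P) (hk : k ∈ I) {C₀ : Finset ℕ}
    (hC₀ : C₀ ∈ P) (hkC₀ : k ∈ C₀) {g : Finset (Finset ℕ) → R}
    (hg : ∀ S ⊆ P, ∀ E', IsFloorForest (k + 1) E' (mergeBlocks k P S) →
      (#(completions I r (k + 1) E' (mergeBlocks k P S)) : R) = g S) :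
    (#(completions I (r + 1) k E P) : R)
      = ∑ S ∈ (P.erase C₀).powerset, (∏ C ∈ S, (#C : R)) * g (insert C₀ S) := by
  -- no edge leaves the last vertex `k`, so its divergence permits a new edge of weight `1`
  have hslot : (⟨k, 1⟩ : Σ _ : ℕ, ℕ) ∈ slots E C₀ := by
    refine mem_slots.2 ⟨hkC₀, le_rfl, ?_⟩
    have : edgeDivergence E k ≤ 0 := edgeDivergence_nonpos fun e he hek => by
      have := h.source_lt_target e he
      have := h.target_le e he
      omega
    push_cast
    omega
  simp only [card_completions_succ h.target_le, hk, forall_const]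
  rw [Nat.cast_sum, sum_congr rfl fun T hT =>
      hg _ (hits_subset P (slots E) T) _ (h.add_vertex (mem_filter.1 hT).1),
    sum_partialTransversals_mem (h.slots_disjoint E) hC₀ hslot]
  refine sum_congr rfl fun S hS => ?_
  congr 1
  refine prod_congr rfl fun C hC => ?_
  rw [card_slots h.divergence_le fun e he =>
    h.mem_block_iff e he C (mem_erase.1 (mem_powerset.1 hS hC)).2]

end Completions

/-! ### Closed formulas for the number of completions -/

section Formulas

/-- The subset sum which governs the addition of one vertex: `S` is the set of components joined to
the new vertex, and the second factor is the shape which all formulas for the number of completions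
of the enlarged forest have. -/
lemma sum_powerset_prod_mul (P : Finset (Finset ℕ)) (X α β x : ℚ) :
    ∑ S ∈ P.powerset, (∏ C ∈ S, (#C : ℚ)) * (X * (∏ C ∈ P \ S, (#C : ℚ))
        * ((α + ∑ C ∈ S, (#C : ℚ)) * x ^ #(P \ S)
          + β * ((∑ C ∈ P \ S, (#C : ℚ)) * x ^ (#(P \ S) - 1))))
      = X * (∏ C ∈ P, (#C : ℚ)) * (α * (1 + x) ^ #P
          + (1 + β) * ((∑ C ∈ P, (#C : ℚ)) * (1 + x) ^ (#P - 1))) := by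
  have key : ∀ S ∈ P.powerset, (∏ C ∈ S, (#C : ℚ)) * (X * (∏ C ∈ P \ S, (#C : ℚ))
        * ((α + ∑ C ∈ S, (#C : ℚ)) * x ^ #(P \ S)
          + β * ((∑ C ∈ P \ S, (#C : ℚ)) * x ^ (#(P \ S) - 1))))
      = X * (∏ C ∈ P, (#C : ℚ)) * (α * x ^ #(P \ S) + (∑ C ∈ S, (#C : ℚ)) * x ^ #(P \ S)
          + β * ((∑ C ∈ P \ S, (#C : ℚ)) * x ^ (#(P \ S) - 1))) := fun S hS => by
    rw [← prod_sdiff (mem_powerset.1 hS)]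
    ring
  rw [sum_congr rfl key, ← mul_sum, sum_add_distrib, sum_add_distrib, ← mul_sum, ← mul_sum,
    sum_powerset_pow_card_sdiff, sum_powerset_sum_mul_pow_card_sdiff,
    sum_powerset_sum_sdiff_mul_pow]
  ring

variable {k r n : ℕ} {E : Multiset (WeightedEdge ℕ)} {P S : Finset (Finset ℕ)} {I : Finset ℕ}

lemma IsPartition.prod_mergeBlocks (h : IsPartition k P) (hS : S ⊆ P) :
    ∏ C ∈ mergeBlocks k P S, (#C : ℚ)
      = (1 + ∑ C ∈ S, (#C : ℚ)) * ∏ C ∈ P \ S, (#C : ℚ) := by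
  rw [mergeBlocks, prod_insert (h.new_notMem _ _), h.card_new hS]
  push_cast
  rfl

lemma IsPartition.card_mergeBlocks' (h : IsPartition k P) (S : Finset (Finset ℕ)) :
    #(mergeBlocks k P S) = #(P \ S) + 1 := by
  rw [mergeBlocks, card_insert_of_notMem (h.new_notMem _ _)]

lemma IsPartition.sum_card_cast (h : IsPartition k P) : ∑ C ∈ P, (#C : ℚ) = k := by
  exact_mod_cast h.sum_card

lemma IsPartition.card_pos (h : IsPartition k P) (hk : 1 ≤ k) : 0 < #P := by
  obtain ⟨C, hC, -⟩ := h.exists_mem hk le_rfl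
  exact Finset.card_pos.2 ⟨C, hC⟩

/-- The number of completions once no further edges are prescribed. -/
lemma card_completions_of_forall_lt (h : IsFloorForest k E P) (hk : 1 ≤ k) (hn : k + r = n)
    (hI : ∀ i ∈ I, i < k) :
    (#(completions I r k E P) : ℚ)
      = (∏ C ∈ P, (#C : ℚ)) * (r : ℚ) ^ (#P - 1) * (n : ℚ) ^ ((r : ℤ) - 1) := by
  have hn0 : (n : ℚ) ≠ 0 := by
    have : n ≠ 0 := by omega
    exact_mod_cast this
  induction r generalizing k E P with
  | zero =>
    have hpos := h.card_pos hk
    rw [completions]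
    split_ifs with hP
    · obtain ⟨C, rfl⟩ := card_eq_one.1 hP
      have hC := h.sum_card_cast
      rw [sum_singleton] at hC
      have hkn : k = n := by omega
      subst hkn
      simp [hC, hn0]
    · rw [Nat.cast_zero, zero_pow (by omega)]
      simp
  | succ r ih =>
    have hkI : k ∉ I := fun hm => lt_irrefl k (hI k hm)
    have hval := sum_powerset_prod_mul P ((n : ℚ) ^ ((r : ℤ) - 1)) 1 0 r
    rw [card_completions_of_notMem h hkI (g := fun S => (n : ℚ) ^ ((r : ℤ) - 1)
        * (∏ C ∈ P \ S, (#C : ℚ)) * ((1 + ∑ C ∈ S, (#C : ℚ)) * (r : ℚ) ^ #(P \ S)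
          + 0 * ((∑ C ∈ P \ S, (#C : ℚ)) * (r : ℚ) ^ (#(P \ S) - 1)))), hval, h.sum_card_cast]
    · obtain ⟨m, hm⟩ : ∃ m, #P = m + 1 := ⟨#P - 1, by have := h.card_pos hk; omega⟩
      have hexp : ((r + 1 : ℕ) : ℤ) - 1 = ((r : ℤ) - 1) + 1 := by push_cast; ring
      have hn' : (n : ℚ) = k + r + 1 := by rw [← hn]; push_cast; ring
      rw [hm, Nat.add_sub_cancel, hexp, zpow_add_one₀ hn0]
      have : (n : ℚ) ^ ((r : ℤ) - 1) * n = (n : ℚ) ^ ((r : ℤ) - 1) * (k + r + 1) := by rw [← hn']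
      rw [this]
      push_cast
      ring
    · intro S hS E' h'
      rw [ih h' (by omega) (by omega) fun i hi => (hI i hi).trans (Nat.lt_succ_self k),
        h.prod_mergeBlocks hS, h.card_mergeBlocks', Nat.add_sub_cancel]
      ring

/-- The number of completions when the edges `k ⟶ k + 1 ⟶ ⋯ ⟶ k + β` of weight `1` and no others
are still prescribed. -/
lemma card_completions_of_chain {β : ℕ} (h : IsFloorForest k E P) (hk : 1 ≤ k)
    (hn : k + r = n) (hI : ∀ i, k ≤ i → (i ∈ I ↔ i < k + β)) (hβ : β ≤ r) {C₀ : Finset ℕ}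
    (hC₀ : C₀ ∈ P) (hkC₀ : k ∈ C₀) :
    (#(completions I r k E P) : ℚ)
      = (n : ℚ) ^ ((r : ℤ) - β - 1) * (∏ C ∈ P.erase C₀, (#C : ℚ))
        * ((β + #C₀) * (r : ℚ) ^ #(P.erase C₀)
          + β * ((∑ C ∈ P.erase C₀, (#C : ℚ)) * (r : ℚ) ^ (#(P.erase C₀) - 1))) := by
  induction β generalizing k r E P C₀ with
  | zero =>
    rw [card_completions_of_forall_lt h hk hn fun i hi => ?_, ← mul_prod_erase P _ hC₀,
      card_erase_of_mem hC₀]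
    · push_cast
      rw [sub_zero]
      ring
    · by_contra hik
      have := (hI i (by omega)).1 hi
      omega
  | succ β ih =>
    obtain ⟨r, rfl⟩ : ∃ r', r = r' + 1 := ⟨r - 1, by omega⟩
    have hkI : k ∈ I := (hI k le_rfl).2 (by omega)
    have hexp : ((r + 1 : ℕ) : ℤ) - ((β + 1 : ℕ) : ℤ) - 1 = (r : ℤ) - β - 1 := by push_cast; ring
    have hval := sum_powerset_prod_mul (P.erase C₀) ((n : ℚ) ^ ((r : ℤ) - β - 1)) (β + 1 + #C₀)
      β r
    rw [card_completions_of_mem h hkI hC₀ hkC₀ (g := fun S => (n : ℚ) ^ ((r : ℤ) - β - 1)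
        * (∏ C ∈ P \ S, (#C : ℚ)) * ((β + 1 + ∑ C ∈ S, (#C : ℚ)) * (r : ℚ) ^ #(P \ S)
          + β * ((∑ C ∈ P \ S, (#C : ℚ)) * (r : ℚ) ^ (#(P \ S) - 1)))), hexp]
    · push_cast
      rw [add_comm (β : ℚ) 1] at hval ⊢
      rw [add_comm (r : ℚ) 1, ← hval]
      refine sum_congr rfl fun S hS => ?_
      have hC₀S : C₀ ∉ S := fun hm => (mem_erase.1 (mem_powerset.1 hS hm)).1 rfl
      have hsd : P \ insert C₀ S = P.erase C₀ \ S := by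
        ext C
        simp only [mem_sdiff, mem_insert, mem_erase]
        tauto
      rw [hsd, sum_insert hC₀S, ← add_assoc]
    · intro S hS E' h'
      have herase : (mergeBlocks k P S).erase (insert (k + 1) (S.biUnion id)) = P \ S := by
        rw [mergeBlocks, erase_insert (h.new_notMem _ _)]
      rw [ih h' (by omega) (by omega) (fun i hi => (hI i (by omega)).trans (by omega)) (by omega)
        (mem_insert_self _ _) (mem_insert_self _ _), herase, h.card_new hS]
      push_cast
      ring

/-- The number of completions when the prescribed edges `a ⟶ a + 1 ⟶ ⋯ ⟶ a + b` of weight `1` are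
all still to come. -/
lemma card_completions_of_lt {a b : ℕ} (h : IsFloorForest k E P) (hka : k < a) (hn : k + r = n)
    (hab : a + b ≤ n) :
    (#(completions (Ico a (a + b)) r k E P) : ℚ)
      = (b + 1) * (n : ℚ) ^ ((r : ℤ) - b - 2) * (∏ C ∈ P, (#C : ℚ))
        * ((r : ℚ) ^ #P + k * (r : ℚ) ^ (#P - 1)) := by
  have hn0 : (n : ℚ) ≠ 0 := by
    have : n ≠ 0 := by omega
    exact_mod_cast this
  induction r generalizing k E P with
  | zero => omega
  | succ r ih =>
    have hkI : k ∉ Ico a (a + b) := by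
      rw [Finset.mem_Ico]
      omega
    have hexp : ((r + 1 : ℕ) : ℤ) - b - 2 = (r : ℤ) - b - 1 := by push_cast; ring
    rw [hexp]
    rcases (Nat.succ_le_of_lt hka).eq_or_lt with hka' | hka'
    · have hval := sum_powerset_prod_mul P ((n : ℚ) ^ ((r : ℤ) - b - 1)) (b + 1) b r
      rw [card_completions_of_notMem h hkI (g := fun S => (n : ℚ) ^ ((r : ℤ) - b - 1)
        * (∏ C ∈ P \ S, (#C : ℚ)) * ((b + 1 + ∑ C ∈ S, (#C : ℚ)) * (r : ℚ) ^ #(P \ S)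
          + b * ((∑ C ∈ P \ S, (#C : ℚ)) * (r : ℚ) ^ (#(P \ S) - 1)))), hval, h.sum_card_cast]
      · push_cast
        ring
      · intro S hS E' h'
        have herase : (mergeBlocks k P S).erase (insert (k + 1) (S.biUnion id)) = P \ S := by
          rw [mergeBlocks, erase_insert (h.new_notMem _ _)]
        rw [card_completions_of_chain (β := b) (n := n) h' (by omega) (by omega)
          (fun i hi => by rw [Finset.mem_Ico]; omega) (by omega)
          (mem_insert_self _ _) (mem_insert_self _ _), herase, h.card_new hS]
        push_cast
        ring
    · have hval := sum_powerset_prod_mul P ((b + 1) * (n : ℚ) ^ ((r : ℤ) - b - 1)) 1 0 r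
      rw [card_completions_of_notMem h hkI (g := fun S => (b + 1) * (n : ℚ) ^ ((r : ℤ) - b - 1)
        * (∏ C ∈ P \ S, (#C : ℚ)) * ((1 + ∑ C ∈ S, (#C : ℚ)) * (r : ℚ) ^ #(P \ S)
          + 0 * ((∑ C ∈ P \ S, (#C : ℚ)) * (r : ℚ) ^ (#(P \ S) - 1)))), hval, h.sum_card_cast]
      · push_cast
        ring
      · intro S hS E' h'
        have hn' : (n : ℚ) = k + r + 1 := by rw [← hn]; push_cast; ring
        have hz : (n : ℚ) ^ ((r : ℤ) - b - 1) = (n : ℚ) ^ ((r : ℤ) - b - 2) * (k + r + 1) := by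
          rw [← hn', ← zpow_add_one₀ hn0]
          congr 1
          ring
        rw [ih h' hka' (by omega), h.prod_mergeBlocks hS, h.card_mergeBlocks',
          Nat.add_sub_cancel, hz]
        push_cast
        ring

/-- The number of completions of the empty forest. -/
lemma card_completions_empty {a b : ℕ} (ha : 1 ≤ a) (hab : a + b ≤ n) :
    (#(completions (Ico a (a + b)) n 0 0 ∅) : ℚ)
      = (b + 1) * (n : ℚ) ^ ((n : ℤ) - b - 2) := by
  rw [card_completions_of_lt IsFloorForest.empty (by omega) (zero_add n) hab]
  simp

end Formulas

/-! ### Completions of the empty forest are floor diagrams -/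

/-- `F` is the edge multiset of a floor diagram of genus `0` on the vertex set `{1, …, d}`;
connectedness is phrased as in `IsFloorForest`. -/
structure IsFloorTree (d : ℕ) (F : Multiset (WeightedEdge ℕ)) : Prop where
  weight_pos : ∀ e ∈ F, 0 < e.weight
  source_lt_target : ∀ e ∈ F, e.source < e.target
  one_le_source : ∀ e ∈ F, 1 ≤ e.source
  target_le : ∀ e ∈ F, e.target ≤ d
  divergence_le : ∀ v, edgeDivergence F v ≤ 1
  card_add_one : F.card + 1 = d
  connected : ∀ Q : ℕ → Prop, (∀ e ∈ F, (Q e.source ↔ Q e.target)) →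
    ∀ u ∈ Icc 1 d, ∀ v ∈ Icc 1 d, Q u → Q v

section Tree

variable {I : Finset ℕ} {d r k : ℕ} {E F : Multiset (WeightedEdge ℕ)} {P : Finset (Finset ℕ)}

lemma IsFloorForest.of_mem_completions (h : IsFloorForest k E P)
    (hF : F ∈ completions I r k E P) :
    (∃ P', IsFloorForest (k + r) F P' ∧ #P' = 1) ∧ E ≤ F ∧
      ∀ i ∈ I, k ≤ i → i < k + r → ⟨i, i + 1, 1⟩ ∈ F := by
  induction r generalizing k E P with
  | zero =>
    rw [completions] at hF
    split_ifs at hF with hP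
    · obtain rfl := mem_singleton.1 hF
      exact ⟨⟨P, h, hP⟩, le_rfl, fun i _ h1 h2 => absurd h1 (by omega)⟩
    · simp at hF
  | succ r ih =>
    obtain ⟨T, hT, hkT, hFT⟩ := mem_completions_succ.1 hF
    obtain ⟨⟨P', hP', hP1⟩, hle, hI⟩ := ih (h.add_vertex hT) hFT
    refine ⟨⟨P', by rwa [← add_assoc, add_right_comm], hP1⟩,
      (Multiset.le_add_right _ _).trans hle, fun i hi h1 h2 => ?_⟩
    rcases h1.eq_or_lt with rfl | h1
    · exact Multiset.mem_of_le hle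
        (Multiset.mem_add.2 (Or.inr (mem_incoming.2 ⟨rfl, hkT hi⟩)))
    · exact hI i hi h1 (by omega)

lemma IsFloorForest.isFloorTree (h : IsFloorForest d F P) (hP : #P = 1) : IsFloorTree d F := by
  obtain ⟨C, rfl⟩ := card_eq_one.1 hP
  have hC : C = Icc 1 d := by simpa using h.biUnion_eq
  subst hC
  have hcard := h.card_add_card
  rw [card_singleton] at hcard
  refine ⟨h.weight_pos, h.source_lt_target, fun e he => ?_, h.target_le, h.divergence_le, hcard,
    fun Q hQ => h.connected _ (mem_singleton_self _) Q hQ⟩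
  have hlt := h.source_lt_target e he
  have hle := h.target_le e he
  exact (Finset.mem_Icc.1 ((h.mem_block_iff e he _ (mem_singleton_self _)).2
    (Finset.mem_Icc.2 ⟨by omega, hle⟩))).1

/-- The sources and weights of the edges of `F` into the vertex `k + 1`. -/
def newSlots (F : Multiset (WeightedEdge ℕ)) (k : ℕ) : Finset (Σ _ : ℕ, ℕ) :=
  ((F.filter fun e => e.target = k + 1).map fun e => (⟨e.source, e.weight⟩ : Σ _ : ℕ, ℕ)).toFinset

/-- The vertex sets of the components of the restriction of `F` to `{1, …, k}`. -/
def blocks (F : Multiset (WeightedEdge ℕ)) : ℕ → Finset (Finset ℕ)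
  | 0 => ∅
  | k + 1 => mergeBlocks k (blocks F k)
      (hits (blocks F k) (slots (F.filter fun e => e.target ≤ k)) (newSlots F k))

lemma mem_newSlots {v w : ℕ} :
    (⟨v, w⟩ : Σ _ : ℕ, ℕ) ∈ newSlots F k ↔ ⟨v, k + 1, w⟩ ∈ F := by
  simp only [newSlots, Multiset.mem_toFinset, Multiset.mem_map, Multiset.mem_filter,
    Sigma.mk.injEq, heq_eq_eq]
  constructor
  · rintro ⟨⟨s, t, u⟩, ⟨he, rfl⟩, rfl, rfl⟩
    exact he
  · intro h
    exact ⟨_, ⟨h, rfl⟩, rfl, rfl⟩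

lemma filter_target_le_succ (F : Multiset (WeightedEdge ℕ)) (k : ℕ) :
    F.filter (fun e => e.target ≤ k + 1)
      = F.filter (fun e => e.target ≤ k) + F.filter fun e => e.target = k + 1 := by
  have hnil : F.filter (fun e => e.target ≤ k ∧ e.target = k + 1) = 0 :=
    Multiset.filter_eq_nil.2 fun e _ => by omega
  rw [Multiset.filter_add_filter, hnil, add_zero]
  exact Multiset.filter_congr fun e _ => by omega

/-- An edge into `k + 1` fits into the divergence bound of the restriction to `{1, …, k}`, because
later edges only increase the divergences of earlier vertices. -/
lemma IsFloorTree.divergence_filter_add_le (h : IsFloorTree d F) {v w : ℕ} (hv : v ≤ k)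
    (he : ⟨v, k + 1, w⟩ ∈ F) :
    edgeDivergence (F.filter fun e => e.target ≤ k) v + w ≤ 1 := by
  have hsplit := Multiset.filter_add_not (fun e : WeightedEdge ℕ => e.target ≤ k) F
  have he' : (⟨v, k + 1, w⟩ : WeightedEdge ℕ) ∈ F.filter fun e => ¬e.target ≤ k :=
    Multiset.mem_filter.2 ⟨he, by simp only; omega⟩
  obtain ⟨G, hG⟩ := Multiset.exists_cons_of_mem he'
  have hGv : 0 ≤ edgeDivergence G v := edgeDivergence_nonneg fun e heG hev => by
    have : e ∈ F.filter fun e => ¬e.target ≤ k := by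
      rw [hG]
      exact Multiset.mem_cons_of_mem heG
    have := (Multiset.mem_filter.1 this).2
    omega
  have hd := h.divergence_le v
  rw [← hsplit, hG, edgeDivergence_add, edgeDivergence_cons, if_pos rfl,
    if_neg (by simp only; omega)] at hd
  simp only at hd
  omega

lemma IsFloorTree.isPartition_blocks (h : IsFloorTree d F) (k : ℕ) :
    IsPartition k (blocks F k) ∧
    (∀ e ∈ F.filter (fun e => e.target ≤ k), ∀ C ∈ blocks F k,
      (e.source ∈ C ↔ e.target ∈ C)) ∧
    newSlots F k ⊆ (blocks F k).biUnion (slots (F.filter fun e => e.target ≤ k)) := by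
  have hnew : ∀ k, IsPartition k (blocks F k) →
      newSlots F k ⊆ (blocks F k).biUnion (slots (F.filter fun e => e.target ≤ k)) := by
    rintro k hP ⟨v, w⟩ hx
    rw [mem_newSlots] at hx
    have hv : v ≤ k := Nat.lt_succ_iff.1 (h.source_lt_target _ hx)
    obtain ⟨C, hC, hvC⟩ := hP.exists_mem (h.one_le_source _ hx) hv
    exact mem_biUnion.2 ⟨C, hC, mem_slots.2 ⟨hvC, h.weight_pos _ hx,
      h.divergence_filter_add_le hv hx⟩⟩
  induction k with
  | zero => exact ⟨IsPartition.empty, by simp [blocks], hnew 0 IsPartition.empty⟩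
  | succ k ih =>
    obtain ⟨hP, hE, hT⟩ := ih
    have hP' : IsPartition (k + 1) (blocks F (k + 1)) := hP.merge (hits_subset _ _ _)
    refine ⟨hP', mem_block_iff_mergeBlocks hP
      (fun e he => h.source_lt_target e (Multiset.mem_filter.1 he).1)
      (fun e he => (Multiset.mem_filter.1 he).2) hE hT fun e he => ?_, hnew _ hP'⟩
    rw [filter_target_le_succ, Multiset.mem_add] at he
    refine he.imp id fun he => ?_
    obtain ⟨heF, hek⟩ := Multiset.mem_filter.1 he
    refine ⟨hek, mem_newSlots.2 ?_⟩
    rwa [← hek]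

lemma IsFloorTree.filter_target_le_self (h : IsFloorTree d F) :
    F.filter (fun e => e.target ≤ d) = F :=
  Multiset.filter_eq_self.2 h.target_le

lemma IsFloorTree.card_blocks (h : IsFloorTree d F) : #(blocks F d) = 1 := by
  obtain ⟨hP, hE, -⟩ := h.isPartition_blocks d
  rw [h.filter_target_le_self] at hE
  have hd : 1 ≤ d := by
    have := h.card_add_one
    omega
  obtain ⟨C, hC, hdC⟩ := hP.exists_mem hd le_rfl
  refine card_eq_one.2 ⟨C, eq_singleton_iff_unique_mem.2 ⟨hC, fun D hD => ?_⟩⟩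
  obtain ⟨v, hv⟩ := hP.nonempty D hD
  have hvC := h.connected (· ∈ C) (fun e he => hE e he C hC) d (Finset.mem_Icc.2 ⟨hd, le_rfl⟩) v
    (Finset.mem_Icc.2 (hP.mem_Icc hD hv)) hdC
  exact hP.eq_of_mem hD hC hv hvC

lemma card_newSlots_le (F : Multiset (WeightedEdge ℕ)) (k : ℕ) :
    #(newSlots F k) ≤ (F.filter fun e => e.target = k + 1).card := by
  rw [newSlots]
  refine (Multiset.toFinset_card_le _).trans ?_
  rw [Multiset.card_map]

/-- The vertex `k + 1` merges at most as many components as there are edges into it. As a tree on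
`d` vertices has only `d - 1` edges, equality holds everywhere. -/
lemma IsFloorTree.card_filter_add_card_blocks (h : IsFloorTree d F) (hk : k ≤ d) :
    (F.filter fun e => e.target ≤ k).card + #(blocks F k) = k := by
  have hmono : Monotone fun k => ((F.filter fun e => e.target ≤ k).card : ℤ) + #(blocks F k)
      - k := by
    refine monotone_nat_of_le_succ fun k => ?_
    obtain ⟨hP, -, hT⟩ := h.isPartition_blocks k
    have h1 : #(blocks F (k + 1)) + _ = _ := hP.card_mergeBlocks (hits_subset _
      (slots (F.filter fun e => e.target ≤ k)) (newSlots F k))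
    have h2 := card_hits_le (hP.slots_disjoint _) hT
    have h3 := card_newSlots_le F k
    rw [filter_target_le_succ, Multiset.card_add]
    push_cast
    omega
  have h0 := hmono (Nat.zero_le k)
  have hd := hmono hk
  have h1 := h.card_add_one
  simp only [h.filter_target_le_self, h.card_blocks] at hd
  simp only [blocks, card_empty] at h0
  push_cast at h0 hd
  omega

/-- Since all inequalities between numbers of merged components and of edges are equalities, the
edges into `k + 1` are distinct and come from distinct components. -/
lemma IsFloorTree.newSlots_spec (h : IsFloorTree d F) (hk : k < d) :
    newSlots F k ∈ partialTransversals (blocks F k) (slots (F.filter fun e => e.target ≤ k)) ∧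
      F.filter (fun e => e.target ≤ k) + incoming k (newSlots F k)
        = F.filter fun e => e.target ≤ k + 1 := by
  obtain ⟨hP, -, hT⟩ := h.isPartition_blocks k
  have h1 : #(blocks F (k + 1)) + _ = _ := hP.card_mergeBlocks (hits_subset _
    (slots (F.filter fun e => e.target ≤ k)) (newSlots F k))
  have h2 := card_hits_le (hP.slots_disjoint _) hT
  have h3 := card_newSlots_le F k
  have h4 := h.card_filter_add_card_blocks hk.le
  have h5 := h.card_filter_add_card_blocks (Nat.succ_le_of_lt hk)
  rw [Nat.succ_eq_add_one, filter_target_le_succ, Multiset.card_add] at h5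
  refine ⟨(card_hits_eq_iff (hP.slots_disjoint _) hT).1 (by omega), ?_⟩
  have hval : (newSlots F k).val
      = (F.filter fun e => e.target = k + 1).map fun e => ⟨e.source, e.weight⟩ := by
    refine Multiset.eq_of_le_of_card_le (Multiset.dedup_le _) ?_
    rw [Multiset.card_map, card_val]
    omega
  rw [filter_target_le_succ, incoming, hval, Multiset.map_map]
  congr 1
  conv_rhs => rw [← Multiset.map_id (F.filter fun e => e.target = k + 1)]
  refine Multiset.map_congr rfl fun e he => ?_
  ext <;> simp [(Multiset.mem_filter.1 he).2]

/-- Every floor diagram arises by adding its vertices one at a time. -/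
lemma IsFloorTree.mem_completions (h : IsFloorTree d F)
    (hI : ∀ i ∈ I, i < d → ⟨i, i + 1, 1⟩ ∈ F) (hk : k + r = d) :
    F ∈ completions I r k (F.filter fun e => e.target ≤ k) (blocks F k) := by
  induction r generalizing k with
  | zero =>
    obtain rfl : k = d := hk
    rw [completions, if_pos h.card_blocks, h.filter_target_le_self]
    exact mem_singleton_self F
  | succ r ih =>
    obtain ⟨hT, hE⟩ := h.newSlots_spec (k := k) (by omega)
    refine mem_completions_succ.2 ⟨_, hT, fun hkI => mem_newSlots.2 (hI k hkI (by omega)), ?_⟩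
    rw [hE]
    exact ih (by omega)

lemma mem_completions_empty_iff :
    F ∈ completions I d 0 0 ∅ ↔ IsFloorTree d F ∧ ∀ i ∈ I, i < d → ⟨i, i + 1, 1⟩ ∈ F := by
  constructor
  · intro hF
    obtain ⟨⟨P, hP, hP1⟩, -, hI⟩ := IsFloorForest.empty.of_mem_completions hF
    rw [zero_add] at hP hI
    exact ⟨hP.isFloorTree hP1, fun i hi => hI i hi (Nat.zero_le i)⟩
  · rintro ⟨h, hI⟩
    have := h.mem_completions hI (zero_add d)
    rwa [Multiset.filter_eq_nil.2] at this
    intro e he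
    have := h.source_lt_target e he
    omega

end Tree

/-! ### Edge multisets on `ℕ` -/

section Transfer

variable {d : ℕ}

/-- The edge of a diagram on `{1, …, d}` as an edge between natural numbers. -/
def edgeToNat (e : WeightedEdge (Icc 1 d)) : WeightedEdge ℕ := ⟨e.source, e.target, e.weight⟩

lemma edgeToNat_injective : Function.Injective (edgeToNat (d := d)) := by
  intro e f h
  simp only [edgeToNat, WeightedEdge.mk.injEq, Subtype.coe_inj] at h
  exact WeightedEdge.ext h.1 h.2.1 h.2.2

lemma edgeDivergence_map_edgeToNat [DecidableEq (Icc 1 d)]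
    (E : Multiset (WeightedEdge (Icc 1 d))) (v : Icc 1 d) :
    edgeDivergence (E.map edgeToNat) v = edgeDivergence E v := by
  induction E using Multiset.induction_on with
  | empty => simp
  | cons e E ih =>
    rw [Multiset.map_cons, edgeDivergence_cons, edgeDivergence_cons, ih]
    simp [edgeToNat]

lemma hasShortEdge_iff {g : ℕ} {D : LabeledFloorDiagram (Icc 1 d) g} {i : ℕ} :
    D.HasShortEdge i ↔ ⟨i, i + 1, 1⟩ ∈ D.edges.map edgeToNat := by
  simp [LabeledFloorDiagram.HasShortEdge, edgeToNat]

lemma isFloorTree_map_edges (D : LabeledFloorDiagram (Icc 1 d) 0) :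
    IsFloorTree d (D.edges.map edgeToNat) := by
  have hex : ∀ e ∈ D.edges.map edgeToNat, ∃ e' ∈ D.edges, edgeToNat e' = e := fun e he =>
    Multiset.mem_map.1 he
  refine ⟨?_, ?_, ?_, ?_, fun v => ?_, ?_, fun Q hQ u hu v hv hQu => ?_⟩
  · intro e he
    obtain ⟨e, he', rfl⟩ := hex e he
    exact D.weight_pos e he'
  · intro e he
    obtain ⟨e, he', rfl⟩ := hex e he
    exact D.source_lt_target e he'
  · intro e he
    obtain ⟨e, he, rfl⟩ := hex e he
    exact (Finset.mem_Icc.1 e.source.2).1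
  · intro e he
    obtain ⟨e, he, rfl⟩ := hex e he
    exact (Finset.mem_Icc.1 e.target.2).2
  · by_cases hv : v ∈ Icc 1 d
    · rw [edgeDivergence_map_edgeToNat D.edges ⟨v, hv⟩]
      exact D.divergence_le ⟨v, hv⟩
    · refine (edgeDivergence_nonpos fun e he hev => ?_).trans zero_le_one
      obtain ⟨e, he, rfl⟩ := hex e he
      exact hv (hev ▸ e.source.2)
  · have := D.genus
    rw [Fintype.card_coe, Nat.card_Icc] at this
    rw [Multiset.card_map]
    omega
  · have hreach := D.connected.preconnected ⟨u, hu⟩ ⟨v, hv⟩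
    rw [SimpleGraph.reachable_iff_reflTransGen] at hreach
    have hQ' : ∀ e ∈ D.edges, (Q e.source ↔ Q e.target) := fun e he =>
      hQ _ (Multiset.mem_map_of_mem edgeToNat he)
    have : ∀ w : Icc 1 d, Relation.ReflTransGen (underlyingGraph D.edges).Adj ⟨u, hu⟩ w →
        Q w := by
      intro w hw
      induction hw with
      | refl => exact hQu
      | tail _ hadj ih =>
        rw [underlyingGraph, SimpleGraph.fromRel_adj] at hadj
        rcases hadj.2 with ⟨e, he, rfl, rfl⟩ | ⟨e, he, rfl, rfl⟩
        · exact (hQ' e he).1 ih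
        · exact (hQ' e he).2 ih
    exact this _ hreach

lemma IsFloorTree.exists_map_edges_eq {F : Multiset (WeightedEdge ℕ)} (h : IsFloorTree d F) :
    ∃ D : LabeledFloorDiagram (Icc 1 d) 0, D.edges.map edgeToNat = F := by
  have hmem : ∀ e ∈ F, e.source ∈ Icc 1 d ∧ e.target ∈ Icc 1 d := fun e he => by
    have h1 := h.one_le_source e he
    have h2 := h.source_lt_target e he
    have h3 := h.target_le e he
    simp only [Finset.mem_Icc]
    omega
  obtain ⟨E, rfl⟩ : ∃ E : Multiset (WeightedEdge (Icc 1 d)), E.map edgeToNat = F := by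
    refine ⟨F.pmap (fun e he => ⟨⟨e.source, he.1⟩, ⟨e.target, he.2⟩, e.weight⟩) hmem, ?_⟩
    rw [Multiset.map_pmap]
    simp only [edgeToNat]
    rw [Multiset.pmap_eq_map, Multiset.map_id']
  have hd : 1 ≤ d := by
    have := h.card_add_one
    omega
  have hE : ∀ e ∈ E, edgeToNat e ∈ E.map edgeToNat := fun e he =>
    Multiset.mem_map_of_mem edgeToNat he
  refine ⟨⟨E, fun e he => h.weight_pos _ (hE e he), ?_, ?_, fun e he =>
    h.source_lt_target _ (hE e he), fun v => ?_⟩, rfl⟩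
  · have : Nonempty (Icc 1 d) := ⟨⟨1, Finset.mem_Icc.2 ⟨le_rfl, hd⟩⟩⟩
    refine ⟨fun u v => ?_⟩
    have hinv : ∀ e ∈ E.map edgeToNat,
        ((∃ hw : e.source ∈ Icc 1 d, (underlyingGraph E).Reachable u ⟨e.source, hw⟩) ↔
          ∃ hw : e.target ∈ Icc 1 d, (underlyingGraph E).Reachable u ⟨e.target, hw⟩) := by
      intro e he
      obtain ⟨e, he', rfl⟩ := Multiset.mem_map.1 he
      have hadj : (underlyingGraph E).Adj e.source e.target := by
        rw [underlyingGraph, SimpleGraph.fromRel_adj]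
        refine ⟨fun heq => ?_, Or.inl ⟨e, he', rfl, rfl⟩⟩
        have := h.source_lt_target _ he
        simp only [edgeToNat, heq, lt_irrefl] at this
      exact ⟨fun ⟨_, hw⟩ => ⟨e.target.2, hw.trans hadj.reachable⟩,
        fun ⟨_, hw⟩ => ⟨e.source.2, hw.trans hadj.symm.reachable⟩⟩
    obtain ⟨_, hv⟩ := h.connected
      (fun w => ∃ hw : w ∈ Icc 1 d, (underlyingGraph E).Reachable u ⟨w, hw⟩) hinv
      u u.2 v v.2 ⟨u.2, .refl u⟩
    exact hv
  · have := h.card_add_one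
    rw [Multiset.card_map] at this
    rw [Fintype.card_coe, Nat.card_Icc]
    omega
  · exact (edgeDivergence_map_edgeToNat E v).symm.le.trans (h.divergence_le v)

lemma ncard_hasShortEdge_Ico {a b : ℕ} (ha : 1 ≤ a) (hab : a + b ≤ d) :
    (Set.ncard {D : LabeledFloorDiagram (Icc 1 d) 0 |
        ∀ i : ℕ, a ≤ i → i < a + b → D.HasShortEdge i} : ℚ)
      = ((b : ℚ) + 1) * (d : ℚ) ^ ((d : ℤ) - (b : ℤ) - 2) := by
  rw [← card_completions_empty ha hab, ← Set.ncard_coe_finset]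
  have hinj : Function.Injective
      fun D : LabeledFloorDiagram (Icc 1 d) 0 => D.edges.map edgeToNat := fun D D' hDD' =>
    LabeledFloorDiagram.ext (Multiset.map_injective edgeToNat_injective hDD')
  rw [← Set.ncard_image_of_injective _ hinj]
  congr 2
  ext F
  rw [mem_coe, mem_completions_empty_iff]
  simp only [Set.mem_image, Set.mem_ofPred_eq, hasShortEdge_iff, Finset.mem_Ico]
  constructor
  · rintro ⟨D, hD, rfl⟩
    exact ⟨isFloorTree_map_edges D, fun i hi _ => hD i hi.1 hi.2⟩
  · rintro ⟨hF, hI⟩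
    obtain ⟨D, rfl⟩ := hF.exists_map_edges_eq
    exact ⟨D, fun i h1 h2 => hI i ⟨h1, h2⟩ (by omega), rfl⟩

end Transfer

end FloorDiagram

theorem mainTheorem10 (d : ℕ) :
    (∀ a : ℕ, 1 ≤ a → a < d →
      (Set.ncard {D : LabeledFloorDiagram (Finset.Icc 1 d) 0 | D.HasShortEdge a} : ℚ)
        = 2 * (d : ℚ) ^ ((d : ℤ) - 3)) ∧
    (∀ a a' : ℕ, 1 ≤ a → a < d → 1 ≤ a' → a' < d →
      Set.ncard {D : LabeledFloorDiagram (Finset.Icc 1 d) 0 | D.HasShortEdge a}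
        = Set.ncard {D : LabeledFloorDiagram (Finset.Icc 1 d) 0 | D.HasShortEdge a'}) ∧
    (∀ a b : ℕ, 1 ≤ a → a < a + b → a + b ≤ d →
      (Set.ncard {D : LabeledFloorDiagram (Finset.Icc 1 d) 0 |
          ∀ i : ℕ, a ≤ i → i < a + b → D.HasShortEdge i} : ℚ)
        = ((b : ℚ) + 1) * (d : ℚ) ^ ((d : ℤ) - (b : ℤ) - 2)) := by
  have hone : ∀ a : ℕ, 1 ≤ a → a < d →
      (Set.ncard {D : LabeledFloorDiagram (Finset.Icc 1 d) 0 | D.HasShortEdge a} : ℚ)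
        = 2 * (d : ℚ) ^ ((d : ℤ) - 3) := by
    intro a ha had
    have h := FloorDiagram.ncard_hasShortEdge_Ico (d := d) (b := 1) ha had
    have hset : {D : LabeledFloorDiagram (Finset.Icc 1 d) 0 |
        ∀ i : ℕ, a ≤ i → i < a + 1 → D.HasShortEdge i} = {D | D.HasShortEdge a} := by
      ext D
      refine ⟨fun hD => hD a le_rfl (Nat.lt_succ_self a), fun hD i h1 h2 => ?_⟩
      obtain rfl : i = a := by omega
      exact hD
    rw [hset] at h
    rw [h]
    congr 1
    · norm_num
    · congr 1
      push_cast
      ring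
  refine ⟨hone, fun a a' ha had ha' had' => ?_, fun a b ha _ hab =>
    FloorDiagram.ncard_hasShortEdge_Ico ha hab⟩
  exact_mod_cast (hone a ha had).trans (hone a' ha' had').symm
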